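/- Let $m_1,m_2,m_3$ (masses), $l_1,l_2,l_3$ (lengths) be positive, and let $F$ (force) and $k_1,k_2$ (stiffnesses) be real. Put \[ \begin{aligned} A_{11}&=m_1l_1^2+m_3l_3^2,\qquad A_{12}=A_{21}=A_{11}+(m_1l_1-m_3l_3)\,l_2\cos\varphi_1,\\ A_{22}&=A_{11}+(m_1+m_2+m_3)\,l_2^2+2(m_1l_1-m_3l_3)\,l_2\cos\varphi_1,\\ r_1&=-k_1\varphi_1-(m_1l_1-m_3l_3)\,l_2v_2^2\sin\varphi_1,\\ r_2&=-Fl_1\sin\varphi_1-k_2\varphi_2+(m_1l_1-m_3l_3)\,l_2v_1(v_1+2v_2)\sin\varphi_1 . \end{aligned} \] For $k_2=0$ the right-hand sides do not depend on $\varphi_2$, and the reduced Ziegler pendulum is the system \[ \dot\varphi_1=v_1,\qquad \dot v_1=\Bigl(r_1-\tfrac{A_{12}}{A_{22}}r_2\Bigr)\Bigl(A_{11}-\tfrac{A_{12}A_{21}}{A_{22}}\Bigr)^{-1},\qquad \dot v_2=\Bigl(r_2-\tfrac{A_{21}}{A_{11}}r_1\Bigr)\Bigl(A_{22}-\tfrac{A_{12}A_{21}}{A_{11}}\Bigr)^{-1}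 \tag{1} \] for $(\varphi_1,v_1,v_2)\in\mathbb R^3$. Take $k_1=k_2=0$ and $F<0$. Let $0<a\le b$ and $R>0$. There is $\varepsilon>0$, depending only on $a,b,R$, such that for every $\eta>0$ there is $r>0$ for which the following holds. For all parameters with $m_i,l_i,-F\in[a,b]$ and $|m_1l_1-m_3l_3|<\varepsilon$, system (1) has a two-parameter family of periodic solutions $\gamma_u$, $u\in U=(0,r)\times(-R,R)$, where $\gamma_u$ is a solution with $\gamma_u(0)=(0,u_1,u_2)$: every $\gamma_u$ is defined for all times and has a least period $T_u>0$; solutions with different $u$ have disjoint orbits; $\gamma_u(t)$ is continuous in $(u,t)$ and $T_u$ in $u$. Every $\gamma_u$ satisfies $|\varphi_1|<\eta$ and $|v_1|<\eta$ at all times, and meets the plane $\varphi_1=0$ exactly twice in a period, once with $v_1>0$ and once with $v_1<0$. The family is a perturbation of solutions of the pendulum equation near its minimum: $\gamma_u(t)$ and $T_u$ are jointly continuous in the parameters $(m_i,l_i,F)$ of the system, $u$ and (for $\gamma$) $t$, and for $m_1l_1=m_3l_3$ the solutions $\gamma_u$ satisfy the decoupled equations \[ \ddot\varphi_1=\frac{Fl_1\sin\varphi_1}{(m_1+m_2+m_3)\,l_2^2},\qquad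 \dot v_2=-\ddot\varphi_1 . \] -/

import Mathlib

open Set

/-- The constants of the double pendulum with a follower force: the point masses `m₁, m₂, m₃`,
the rod lengths `l₁, l₂, l₃`, the (signed) magnitude `F` of the follower force and the
stiffnesses `k₁, k₂` of the two springs. -/
structure Ziegler where
  m₁ : ℝ
  m₂ : ℝ
  m₃ : ℝ
  l₁ : ℝ
  l₂ : ℝ
  l₃ : ℝ
  F : ℝ
  k₁ : ℝ
  k₂ : ℝ

namespace Ziegler

/-- The nine constants as a point of `ℝ⁹`. -/
def toTuple (P : Ziegler) : ℝ × ℝ × ℝ × ℝ × ℝ × ℝ × ℝ × ℝ × ℝ :=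
  (P.m₁, P.m₂, P.m₃, P.l₁, P.l₂, P.l₃, P.F, P.k₁, P.k₂)

/-- The space of constants carries the topology of `ℝ⁹`. -/
instance : TopologicalSpace Ziegler := TopologicalSpace.induced toTuple inferInstance

noncomputable section

/-- `m₁ l₁ - m₃ l₃`, the quantity that measures the distance to the decoupled case. -/
def imbalance (P : Ziegler) : ℝ := P.m₁ * P.l₁ - P.m₃ * P.l₃

def A₁₁ (P : Ziegler) : ℝ := P.m₁ * P.l₁ ^ 2 + P.m₃ * P.l₃ ^ 2

def A₁₂ (P : Ziegler) (φ₁ : ℝ) : ℝ :=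
  P.m₁ * P.l₁ ^ 2 + P.m₃ * P.l₃ ^ 2 + P.m₁ * P.l₁ * P.l₂ * Real.cos φ₁
    - P.m₃ * P.l₂ * P.l₃ * Real.cos φ₁

def A₂₁ (P : Ziegler) (φ₁ : ℝ) : ℝ := P.A₁₂ φ₁

def A₂₂ (P : Ziegler) (φ₁ : ℝ) : ℝ :=
  P.m₁ * P.l₂ ^ 2 + P.m₁ * P.l₁ ^ 2 + P.m₂ * P.l₂ ^ 2 + P.m₃ * P.l₂ ^ 2 + P.m₃ * P.l₃ ^ 2
    + 2 * P.m₁ * P.l₁ * P.l₂ * Real.cos φ₁ - 2 * P.m₃ * P.l₂ * P.l₃ * Real.cos φ₁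

/-- First right-hand side of the Lagrange equations `A φ'' = r`. -/
def r₁ (P : Ziegler) (φ₁ v₂ : ℝ) : ℝ :=
  -P.k₁ * φ₁ - P.m₁ * P.l₁ * P.l₂ * v₂ ^ 2 * Real.sin φ₁
    + P.m₃ * P.l₂ * P.l₃ * v₂ ^ 2 * Real.sin φ₁

/-- Second right-hand side of the Lagrange equations `A φ'' = r`. -/
def r₂ (P : Ziegler) (φ₁ φ₂ v₁ v₂ : ℝ) : ℝ :=
  -P.F * P.l₁ * Real.sin φ₁ - P.k₂ * φ₂
    + P.m₁ * P.l₁ * P.l₂ * v₁ * (v₁ + 2 * v₂) * Real.sin φ₁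
    - P.m₃ * P.l₂ * P.l₃ * v₁ * (v₁ + 2 * v₂) * Real.sin φ₁

/-- The vector field of the reduced third-order system in the variables `(φ₁, v₁, v₂)`. It is the
reduced system only when `k₂ = 0`; then `r₂` does not depend on `φ₂`, which is set to `0` here. -/
def reducedField (P : Ziegler) (x : ℝ × ℝ × ℝ) : ℝ × ℝ × ℝ :=
  (x.2.1,
   (P.r₁ x.1 x.2.2 - P.A₁₂ x.1 / P.A₂₂ x.1 * P.r₂ x.1 0 x.2.1 x.2.2) *
     (P.A₁₁ - P.A₁₂ x.1 * P.A₂₁ x.1 / P.A₂₂ x.1)⁻¹,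
   (P.r₂ x.1 0 x.2.1 x.2.2 - P.A₂₁ x.1 / P.A₁₁ * P.r₁ x.1 x.2.2) *
     (P.A₂₂ x.1 - P.A₁₂ x.1 * P.A₂₁ x.1 / P.A₁₁)⁻¹)

/-- `γ : t ↦ (φ₁, v₁, v₂)` is a solution, defined for all times, of the reduced system. -/
def IsReducedSolution (P : Ziegler) (γ : ℝ → ℝ × ℝ × ℝ) : Prop :=
  ∀ t, HasDerivAt γ (P.reducedField (γ t)) t

/-- `γ u`, for `u` in a nonempty open set `U` of the plane, is a two-parameter family of periodic
solutions of the reduced system: `γ u` has least period `T u > 0` (so it is not constant), solutions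
with different parameters have disjoint orbits, and solutions and periods depend continuously on
the parameters. -/
structure IsPeriodicFamily (P : Ziegler) (U : Set (ℝ × ℝ))
    (γ : ℝ × ℝ → ℝ → ℝ × ℝ × ℝ) (T : ℝ × ℝ → ℝ) : Prop where
  isOpen : IsOpen U
  nonempty : U.Nonempty
  solution : ∀ u ∈ U, P.IsReducedSolution (γ u)
  period_pos : ∀ u ∈ U, 0 < T u
  periodic : ∀ u ∈ U, Function.Periodic (γ u) (T u)
  period_least : ∀ u ∈ U, ∀ s, 0 < s → Function.Periodic (γ u) s → T u ≤ s
  disjoint : ∀ u ∈ U, ∀ w ∈ U, u ≠ w → Disjoint (range (γ u)) (range (γ w))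
  continuousOn : ContinuousOn (fun q : (ℝ × ℝ) × ℝ => γ q.1 q.2) (U ×ˢ univ)
  continuousOn_period : ContinuousOn T U

/-- `γ : t ↦ (φ₁, v₁, v₂)` solves the decoupled system with `k₁ = 0`: the pendulum equation
`φ₁'' = F l₁ sin φ₁ / ((m₁ + m₂ + m₃) l₂²)`, together with `v₂' = -φ₁''`. -/
def IsDecoupledSolution (P : Ziegler) (γ : ℝ → ℝ × ℝ × ℝ) : Prop :=
  ∀ t, HasDerivAt γ
    ((γ t).2.1,
     P.F * P.l₁ * Real.sin (γ t).1 / ((P.m₁ + P.m₂ + P.m₃) * P.l₂ ^ 2),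
     -(P.F * P.l₁ * Real.sin (γ t).1 / ((P.m₁ + P.m₂ + P.m₃) * P.l₂ ^ 2))) t

/-- The constants with `k₁ = k₂ = 0`, masses and lengths in `[a, b]`, `F` in `[-b, -a]`, and
`|m₁ l₁ - m₃ l₃| < ε`. -/
def nearDecoupled (a b ε : ℝ) : Set Ziegler :=
  {P | P.k₁ = 0 ∧ P.k₂ = 0 ∧ P.m₁ ∈ Icc a b ∧ P.m₂ ∈ Icc a b ∧ P.m₃ ∈ Icc a b ∧
    P.l₁ ∈ Icc a b ∧ P.l₂ ∈ Icc a b ∧ P.l₃ ∈ Icc a b ∧ P.F ∈ Icc (-b) (-a) ∧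
    |P.imbalance| < ε}

end

end Ziegler

section Flow

open Filter Topology
open scoped NNReal

variable {E : Type*} [NormedAddCommGroup E] [NormedSpace ℝ E]

/-- A bounded Lipschitz vector field on a Banach space is complete. -/
theorem LipschitzWith.exists_global_solution [CompleteSpace E] {f : E → E} {K L : ℝ≥0}
    (hf : LipschitzWith K f) (hL : ∀ x, ‖f x‖ ≤ L) (x : E) :
    ∃ γ : ℝ → E, γ 0 = x ∧ ∀ t, HasDerivAt γ (f (γ t)) t := by
  have local_sol (n : ℕ) : ∃ α : ℝ → E, α 0 = x ∧
      ∀ t ∈ Ioo (-(n : ℝ)) n, HasDerivAt α (f (α t)) t := by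
    have h0 : (0 : ℝ) ∈ Icc (-(n : ℝ)) n := by simp
    have hpl : IsPicardLindelof (fun _ => f) (⟨0, h0⟩ : Icc (-(n : ℝ)) n) x (L * n) 0 L K := by
      refine IsPicardLindelof.of_time_independent (fun y _ => hL y) hf.lipschitzOnWith ?_
      simp
    obtain ⟨α, hα, hα'⟩ := hpl.exists_eq_forall_mem_Icc_hasDerivWithinAt₀
    exact ⟨α, hα, fun t ht => (hα' t (Ioo_subset_Icc_self ht)).hasDerivAt
      (Icc_mem_nhds ht.1 ht.2)⟩
  choose α hα0 hα using local_sol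
  have agree {m n : ℕ} (hm : 0 < m) (hmn : m ≤ n) : EqOn (α m) (α n) (Ioo (-(m : ℝ)) m) := by
    have hmn' : (m : ℝ) ≤ n := by exact_mod_cast hmn
    have hm' : (0 : ℝ) < m := by exact_mod_cast hm
    refine ODE_solution_unique_of_mem_Ioo (v := fun _ => f) (s := fun _ => univ) (K := K)
      (t₀ := 0) (fun t _ => hf.lipschitzOnWith) ⟨by linarith, hm'⟩
      (fun t ht => ⟨hα m t ht, mem_univ _⟩) (fun t ht => ⟨hα n t ⟨?_, ?_⟩, mem_univ _⟩) ?_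
    · linarith [ht.1]
    · linarith [ht.2]
    · rw [hα0, hα0]
  have glue (n : ℕ) : EqOn (fun t => α (⌊|t|⌋₊ + 1) t) (α n) (Ioo (-(n : ℝ)) n) := by
    intro t ht
    refine agree (Nat.succ_pos _) ?_ ?_
    · exact Nat.succ_le_of_lt ((Nat.floor_lt (abs_nonneg t)).2 (abs_lt.2 ht))
    · rw [mem_Ioo, ← abs_lt]
      exact_mod_cast Nat.lt_floor_add_one |t|
  refine ⟨fun t => α (⌊|t|⌋₊ + 1) t, by simp [hα0], fun t => ?_⟩
  have ht : t ∈ Ioo (-((⌊|t|⌋₊ + 1 : ℕ) : ℝ)) ((⌊|t|⌋₊ + 1 : ℕ) : ℝ) := by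
    rw [mem_Ioo, ← abs_lt]
    exact_mod_cast Nat.lt_floor_add_one |t|
  exact (hα _ t ht).congr_of_eventuallyEq
    (Filter.eventuallyEq_of_mem (Ioo_mem_nhds ht.1 ht.2) (glue _))

theorem LipschitzWith.dist_solution_le_of_nonneg {f : E → E} {K : ℝ≥0} (hf : LipschitzWith K f)
    {γ δ : ℝ → E} (hγ : ∀ t, HasDerivAt γ (f (γ t)) t) (hδ : ∀ t, HasDerivAt δ (f (δ t)) t)
    {t : ℝ} (ht : 0 ≤ t) : dist (γ t) (δ t) ≤ dist (γ 0) (δ 0) * Real.exp (K * t) := by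
  have := dist_le_of_trajectories_ODE (v := fun _ => f) (K := K) (a := 0) (b := t)
    (fun _ => hf) (fun s _ => (hγ s).continuousAt.continuousWithinAt)
    (fun s _ => (hγ s).hasDerivWithinAt)
    (fun s _ => (hδ s).continuousAt.continuousWithinAt)
    (fun s _ => (hδ s).hasDerivWithinAt) le_rfl t ⟨ht, le_rfl⟩
  simpa using this

theorem LipschitzWith.dist_solution_le {f : E → E} {K : ℝ≥0} (hf : LipschitzWith K f)
    {γ δ : ℝ → E} (hγ : ∀ t, HasDerivAt γ (f (γ t)) t) (hδ : ∀ t, HasDerivAt δ (f (δ t)) t)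
    (t : ℝ) : dist (γ t) (δ t) ≤ dist (γ 0) (δ 0) * Real.exp (K * |t|) := by
  rcases le_total 0 t with ht | ht
  · rw [abs_of_nonneg ht]
    exact hf.dist_solution_le_of_nonneg hγ hδ ht
  · have rev {γ : ℝ → E} (hγ : ∀ t, HasDerivAt γ (f (γ t)) t) (t : ℝ) :
        HasDerivAt (fun s => γ (-s)) (-f (γ (-t))) t := by
      exact ((hγ (-t)).scomp t (hasDerivAt_neg t)).congr_deriv (by simp)
    have := hf.neg.dist_solution_le_of_nonneg (rev hγ) (rev hδ) (neg_nonneg.2 ht)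
    simpa [abs_of_nonpos ht] using this

/-- The flow of a Lipschitz vector field is jointly continuous in initial value and time. -/
theorem LipschitzWith.continuous_flow {f : E → E} {K : ℝ≥0} (hf : LipschitzWith K f)
    {Φ : E → ℝ → E} (h0 : ∀ x, Φ x 0 = x) (hΦ : ∀ x t, HasDerivAt (Φ x) (f (Φ x t)) t) :
    Continuous fun p : E × ℝ => Φ p.1 p.2 := by
  refine continuous_iff_continuousAt.2 fun ⟨x, t⟩ => ?_
  rw [ContinuousAt, tendsto_iff_dist_tendsto_zero]
  have hx : Continuous (Φ x) := continuous_iff_continuousAt.2 fun s => (hΦ x s).continuousAt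
  have hbound : Tendsto (fun p : E × ℝ => dist p.1 x * Real.exp (K * |p.2|) +
      dist (Φ x p.2) (Φ x t)) (𝓝 (x, t)) (𝓝 0) := by
    have : Continuous fun p : E × ℝ => dist p.1 x * Real.exp (K * |p.2|) +
        dist (Φ x p.2) (Φ x t) := by fun_prop
    simpa using this.tendsto (x, t)
  refine squeeze_zero (fun _ => dist_nonneg) (fun p => ?_) hbound
  refine (dist_triangle _ (Φ x p.2) _).trans ?_
  gcongr
  simpa [h0] using hf.dist_solution_le (hΦ p.1) (hΦ x) p.2

/-- A solution of a reversible system that meets the fixed space of the reversor is symmetric. -/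
theorem LipschitzWith.reversible_solution {f : E → E} {K : ℝ≥0} (hf : LipschitzWith K f)
    (σ : E →L[ℝ] E) (hσ : ∀ x, f (σ x) = -σ (f x)) {γ : ℝ → E}
    (hγ : ∀ t, HasDerivAt γ (f (γ t)) t) {t₀ : ℝ} (h0 : σ (γ t₀) = γ t₀) (t : ℝ) :
    γ (2 * t₀ - t) = σ (γ t) := by
  have h : ∀ t, HasDerivAt (fun s => σ (γ (2 * t₀ - s))) (f (σ (γ (2 * t₀ - t)))) t := by
    intro t
    have h1 : HasDerivAt (fun s : ℝ => 2 * t₀ - s) (-1) t := by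
      simpa using (hasDerivAt_id t).const_sub (2 * t₀)
    have h2 := σ.hasFDerivAt.comp_hasDerivAt t ((hγ (2 * t₀ - t)).scomp t h1)
    exact h2.congr_deriv (by simp [hσ])
  have heq := ODE_solution_unique_univ (v := fun _ => f) (s := fun _ => univ) (K := K) (t₀ := t₀)
    (fun _ => hf.lipschitzOnWith) (fun t => ⟨hγ t, mem_univ _⟩) (fun t => ⟨h t, mem_univ _⟩)
    (by simp only [two_mul, add_sub_cancel_right, h0])
  have := congrFun heq (2 * t₀ - t)
  simpa using this

/-- A solution of a reversible system that meets the fixed space of the reversor twice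
is periodic. -/
theorem LipschitzWith.periodic_of_reversible {f : E → E} {K : ℝ≥0} (hf : LipschitzWith K f)
    (σ : E →L[ℝ] E) (hσ : ∀ x, f (σ x) = -σ (f x)) {γ : ℝ → E}
    (hγ : ∀ t, HasDerivAt γ (f (γ t)) t) {τ : ℝ} (h0 : σ (γ 0) = γ 0) (hτ : σ (γ τ) = γ τ) :
    Function.Periodic γ (2 * τ) := by
  intro t
  have h1 := hf.reversible_solution σ hσ hγ hτ (-t)
  have h2 := hf.reversible_solution σ hσ hγ h0 t
  have h3 := hf.reversible_solution σ hσ hγ h0 (-t)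
  simp only [mul_zero, zero_sub, neg_neg] at h2 h3
  rw [← h3] at h1
  rw [← h1]
  ring_nf

end Flow

section FirstReturn

open Filter Topology

/-- Sturm comparison with `x'' = -ω² x`. -/
theorem exists_nonpos_of_sturm {φ v a : ℝ → ℝ} {ω : ℝ} (hω : 0 < ω)
    (hφ : ∀ t ∈ Icc 0 (Real.pi / ω), HasDerivAt φ (v t) t)
    (hv : ∀ t ∈ Icc 0 (Real.pi / ω), HasDerivAt v (a t) t) (h0 : φ 0 = 0)
    (ha : ∀ t ∈ Ioc 0 (Real.pi / ω), 0 < φ t → a t ≤ -ω ^ 2 * φ t) :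
    ∃ t ∈ Ioc 0 (Real.pi / ω), φ t ≤ 0 := by
  by_contra! hpos
  have hT : 0 < Real.pi / ω := div_pos Real.pi_pos hω
  have hq (t : ℝ) (ht : t ∈ Icc 0 (Real.pi / ω)) : HasDerivAt (fun t => v t * Real.sin (ω * t) - φ t * (ω * Real.cos (ω * t)))
      ((a t + ω ^ 2 * φ t) * Real.sin (ω * t)) t := by
    have h1 : HasDerivAt (fun t : ℝ => ω * t) ω t := by simpa using (hasDerivAt_id t).const_mul ω
    have h2 := ((hv t ht).mul h1.sin).sub ((hφ t ht).mul (h1.cos.const_mul ω))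
    refine h2.congr_deriv ?_
    ring
  have hanti : AntitoneOn (fun t => v t * Real.sin (ω * t) - φ t * (ω * Real.cos (ω * t)))
      (Icc 0 (Real.pi / ω)) := by
    refine antitoneOn_of_deriv_nonpos (convex_Icc _ _)
      (fun t ht => (hq t ht).continuousAt.continuousWithinAt)
      (fun t ht => (hq t (interior_subset ht)).differentiableAt.differentiableWithinAt)
      fun t ht => ?_
    rw [(hq t (interior_subset ht)).deriv]
    rw [interior_Icc] at ht
    have hωt : ω * t ≤ Real.pi := by
      have := (lt_div_iff₀ hω).1 ht.2
      linarith
    have ht' : t ∈ Ioc 0 (Real.pi / ω) := Ioo_subset_Ioc_self ht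
    exact mul_nonpos_of_nonpos_of_nonneg (by linarith [ha t ht' (hpos t ht')])
      (Real.sin_nonneg_of_nonneg_of_le_pi (mul_nonneg hω.le ht.1.le) hωt)
  have h := hanti (left_mem_Icc.2 hT.le) (right_mem_Icc.2 hT.le) hT.le
  have hω' : ω * (Real.pi / ω) = Real.pi := by field_simp
  simp only [h0, hω', mul_zero, Real.sin_zero, Real.sin_pi, Real.cos_pi] at h
  nlinarith [hpos _ (right_mem_Ioc.2 hT)]

/-- `τ` is the first positive zero of `φ`, and `φ` is positive before. -/
structure IsFirstReturn (φ : ℝ → ℝ) (τ : ℝ) : Prop where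
  pos : 0 < τ
  pos_before : ∀ t ∈ Ioo 0 τ, 0 < φ t
  zero : φ τ = 0

theorem eventually_pos_of_hasDerivAt {φ : ℝ → ℝ} {v : ℝ} (hφ : HasDerivAt φ v 0)
    (h0 : φ 0 = 0) (hv : 0 < v) : ∀ᶠ t in 𝓝[>] 0, 0 < φ t := by
  have h := (hasDerivAt_iff_tendsto_slope.1 hφ).eventually (lt_mem_nhds hv)
  have h' : ∀ᶠ t in 𝓝[>] (0 : ℝ), 0 < slope φ 0 t :=
    h.filter_mono (nhdsWithin_mono _ fun t ht => (mem_Ioi.1 ht).ne')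
  filter_upwards [h', self_mem_nhdsWithin] with t ht ht0
  rw [slope_def_field, h0, sub_zero, sub_zero] at ht
  exact (div_pos_iff_of_pos_right ht0).1 ht

theorem exists_isFirstReturn {φ : ℝ → ℝ} {v T : ℝ} (hcont : Continuous φ)
    (hφ : HasDerivAt φ v 0) (h0 : φ 0 = 0) (hv : 0 < v) (hT : ∃ t ∈ Ioc 0 T, φ t ≤ 0) :
    ∃ τ ∈ Ioc 0 T, IsFirstReturn φ τ := by
  obtain ⟨t₁, ht₁, hφt₁⟩ := hT
  obtain ⟨d, hd, hd'⟩ := mem_nhdsGT_iff_exists_Ioo_subset.1 (eventually_pos_of_hasDerivAt hφ h0 hv)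
  have hd0 : (0 : ℝ) < d := hd
  have hcpt : IsCompact (Icc (d / 2) t₁ ∩ φ ⁻¹' Iic 0) :=
    isCompact_Icc.inter_right (isClosed_Iic.preimage hcont)
  have hdt : d ≤ t₁ := by
    by_contra! h
    exact absurd (hd' ⟨ht₁.1, h⟩) (not_lt.2 hφt₁)
  obtain ⟨τ, ⟨⟨hτ1, hτ2⟩, hτ3⟩, hmin⟩ := hcpt.exists_isLeast ⟨t₁, ⟨by linarith, le_rfl⟩, hφt₁⟩
  have hpos : ∀ t ∈ Ioo 0 τ, 0 < φ t := by
    intro t ht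
    by_contra! hle
    rcases lt_or_ge t (d / 2) with h | h
    · exact absurd (hd' ⟨ht.1, by linarith⟩) (not_lt.2 hle)
    · exact absurd (hmin ⟨⟨h, ht.2.le.trans hτ2⟩, hle⟩) (not_le.2 ht.2)
  have hτ0 : 0 < τ := by linarith
  refine ⟨τ, ⟨hτ0, hτ2.trans ht₁.2⟩, hτ0, hpos, le_antisymm hτ3 ?_⟩
  have hcl : closure (Ioo 0 τ) = Icc 0 τ := closure_Ioo hτ0.ne
  have : Icc 0 τ ⊆ φ ⁻¹' Ici 0 := hcl ▸ closure_minimal (fun t ht => (hpos t ht).le)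
    (isClosed_Ici.preimage hcont)
  exact this (right_mem_Icc.2 hτ0.le)

/-- At the first return the velocity is negative if the acceleration is negative before. -/
theorem IsFirstReturn.deriv_neg {φ v a : ℝ → ℝ} {τ : ℝ} (h : IsFirstReturn φ τ)
    (hφ : ∀ t ∈ Icc 0 τ, HasDerivAt φ (v t) t) (hv : ∀ t ∈ Icc 0 τ, HasDerivAt v (a t) t)
    (h0 : φ 0 = 0)
    (ha : ∀ t ∈ Ioo 0 τ, a t < 0) : v τ < 0 := by
  obtain ⟨s, hs, hs'⟩ := exists_hasDerivAt_eq_zero h.pos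
    (fun t ht => (hφ t ht).continuousAt.continuousWithinAt) (h0.trans h.zero.symm)
    fun t ht => hφ t (Ioo_subset_Icc_self ht)
  have hanti : StrictAntiOn v (Icc 0 τ) := by
    refine strictAntiOn_of_deriv_neg (convex_Icc _ _)
      (fun t ht => (hv t ht).continuousAt.continuousWithinAt) fun t ht => ?_
    rw [(hv t (interior_subset ht)).deriv]
    rw [interior_Icc] at ht
    exact ha t ht
  have := hanti (Ioo_subset_Icc_self hs) (right_mem_Icc.2 h.pos.le) hs.2
  linarith

/-- The time of first return depends continuously on parameters. -/
theorem continuousOn_firstReturn {X : Type*} [TopologicalSpace X] {S : Set X}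
    {φ v : X → ℝ → ℝ} {τ : X → ℝ} (hφ : ∀ x t, HasDerivAt (φ x) (v x t) t)
    (hφc : Continuous fun p : X × ℝ => φ p.1 p.2) (hvc : Continuous fun p : X × ℝ => v p.1 p.2)
    (h0 : ∀ x ∈ S, φ x 0 = 0) (hv0 : ∀ x ∈ S, 0 < v x 0)
    (hτ : ∀ x ∈ S, IsFirstReturn (φ x) (τ x)) (hvτ : ∀ x ∈ S, v x (τ x) < 0) :
    ContinuousOn τ S := by
  intro x hx
  have hτx := hτ x hx
  rw [ContinuousWithinAt, tendsto_order]
  constructor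
  · intro t ht
    wlog ht0 : 0 < t generalizing t
    · have := this (τ x / 2) (by linarith [hτx.pos]) (by linarith [hτx.pos])
      filter_upwards [this] with y hy
      linarith [hτx.pos]
    have hvx : ∀ᶠ s in 𝓝 (0 : ℝ), 0 < v x s :=
      (hvc.comp (Continuous.prodMk_right x)).continuousAt.eventually (lt_mem_nhds (hv0 x hx))
    obtain ⟨d, hd, hd'⟩ := Metric.eventually_nhds_iff.1 hvx
    have hvnear : ∀ᶠ y in 𝓝 x, ∀ s ∈ Icc 0 (d / 2), 0 < v y s := by
      refine isCompact_Icc.eventually_forall_of_forall_eventually fun s hs => ?_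
      refine hvc.continuousAt.eventually (lt_mem_nhds (hd' ?_))
      rw [Real.dist_eq, sub_zero, abs_of_nonneg hs.1]
      linarith [hs.2]
    have hφnear : ∀ᶠ y in 𝓝 x, ∀ s ∈ Icc (d / 2) t, 0 < φ y s := by
      refine isCompact_Icc.eventually_forall_of_forall_eventually fun s hs => ?_
      exact hφc.continuousAt.eventually
        (lt_mem_nhds (hτx.pos_before s ⟨by linarith [hs.1], hs.2.trans_lt ht⟩))
    filter_upwards [nhdsWithin_le_nhds hvnear, nhdsWithin_le_nhds hφnear, self_mem_nhdsWithin]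
      with y hy1 hy2 hyS
    by_contra! hle
    have hτy := hτ y hyS
    rcases le_total (τ y) (d / 2) with h | h
    · obtain ⟨s, hs, hs'⟩ := exists_hasDerivAt_eq_zero hτy.pos
        (fun t _ => (hφ y t).continuousAt.continuousWithinAt) ((h0 y hyS).trans hτy.zero.symm)
        fun t _ => hφ y t
      exact (hy1 s ⟨hs.1.le, hs.2.le.trans h⟩).ne' hs'
    · exact (hy2 _ ⟨h, hle⟩).ne' hτy.zero
  · intro t ht
    have hneg : ∃ s ∈ Ioo (τ x) t, φ x s < 0 := by
      have h1 : HasDerivAt (fun s => -φ x (s + τ x)) (-v x (τ x)) 0 := by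
        have h2 : HasDerivAt (φ x) (v x (τ x)) (0 + τ x) := by simpa using hφ x (τ x)
        exact (h2.comp_add_const 0 (τ x)).neg
      have h3 := eventually_pos_of_hasDerivAt h1 (by simp [hτx.zero]) (by linarith [hvτ x hx])
      have h4 : ∀ᶠ s in 𝓝[>] (0 : ℝ), s ∈ Ioo 0 (t - τ x) := Ioo_mem_nhdsGT (by linarith)
      obtain ⟨s, hs, hs'⟩ := (h3.and h4).exists
      exact ⟨s + τ x, ⟨by linarith [hs'.1], by linarith [hs'.2]⟩, by linarith⟩
    obtain ⟨s, hs, hs'⟩ := hneg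
    have hnear : ∀ᶠ y in 𝓝 x, φ y s < 0 :=
      (hφc.comp (Continuous.prodMk_left s)).continuousAt.eventually (gt_mem_nhds hs')
    filter_upwards [nhdsWithin_le_nhds hnear, self_mem_nhdsWithin] with y hy hyS
    by_contra! hle
    have := (hτ y hyS).pos_before s ⟨by linarith [hs.1, hτx.pos], hs.2.trans_le hle⟩
    linarith

end FirstReturn

section Pendulum

open Filter Topology
open scoped NNReal

/-- The determinant `A₁₁ A₂₂ - A₁₂ A₂₁` in terms of `q = (J, N, μ, f)`, see `coupledField`. -/
noncomputable def couplingDet (q : ℝ × ℝ × ℝ × ℝ) (φ : ℝ) : ℝ :=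
  q.1 * q.2.1 - (q.2.2.1 * Real.cos φ) ^ 2

/-- The numerator of `v₁' / sin φ₁`. -/
noncomputable def couplingNum₁ (q : ℝ × ℝ × ℝ × ℝ) (x : ℝ × ℝ × ℝ) : ℝ :=
  -(q.2.2.1 * x.2.2 ^ 2 * (q.1 + q.2.1 + 2 * q.2.2.1 * Real.cos x.1)) -
    (q.1 + q.2.2.1 * Real.cos x.1) * (q.2.2.2 + q.2.2.1 * (x.2.1 * (x.2.1 + 2 * x.2.2)))

/-- The numerator of `v₂' / sin φ₁`. -/
noncomputable def couplingNum₂ (q : ℝ × ℝ × ℝ × ℝ) (x : ℝ × ℝ × ℝ) : ℝ :=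
  q.1 * (q.2.2.2 + q.2.2.1 * (x.2.1 * (x.2.1 + 2 * x.2.2))) +
    (q.1 + q.2.2.1 * Real.cos x.1) * (q.2.2.1 * x.2.2 ^ 2)

/-- The reduced Ziegler field for `k₁ = k₂ = 0`, in terms of `q = (J, N, μ, f)` where `J = A₁₁`,
`N = (m₁ + m₂ + m₃) l₂²`, `μ = (m₁ l₁ - m₃ l₃) l₂` and `f = -F l₁`. -/
noncomputable def coupledField (q : ℝ × ℝ × ℝ × ℝ) (x : ℝ × ℝ × ℝ) : ℝ × ℝ × ℝ :=
  (x.2.1, Real.sin x.1 * (couplingNum₁ q x / couplingDet q x.1),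
    Real.sin x.1 * (couplingNum₂ q x / couplingDet q x.1))

/-- The compact range of the parameters `(J, N, μ, f)`. -/
def paramBox (α β δ : ℝ) : Set (ℝ × ℝ × ℝ × ℝ) :=
  Icc α β ×ˢ Icc α β ×ˢ Icc (-δ) δ ×ˢ Icc α β

/-- The compact range of the states `(φ₁, v₁, v₂)`. -/
def stateBox (B : ℝ) : Set (ℝ × ℝ × ℝ) :=
  Icc (-1) 1 ×ˢ Icc (-1) 1 ×ˢ Icc (-B) B

theorem le_couplingDet {α β δ : ℝ} (hα : 0 < α) (hδ : δ ≤ α / 2) {q : ℝ × ℝ × ℝ × ℝ}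
    (hq : q ∈ paramBox α β δ) (φ : ℝ) : α ^ 2 / 2 ≤ couplingDet q φ := by
  obtain ⟨⟨hJ, -⟩, ⟨hN, -⟩, hμ, -⟩ := hq
  have hμ' : |q.2.2.1| ≤ α / 2 := (abs_le.2 hμ).trans hδ
  have hc : |q.2.2.1 * Real.cos φ| ≤ α / 2 := by
    rw [abs_mul]
    calc _ ≤ |q.2.2.1| * 1 := by gcongr; exact Real.abs_cos_le_one φ
      _ ≤ _ := by simpa using hμ'
  have hsq : (q.2.2.1 * Real.cos φ) ^ 2 ≤ (α / 2) ^ 2 := sq_le_sq' (abs_le.1 hc).1 (abs_le.1 hc).2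
  have hJN : α * α ≤ q.1 * q.2.1 := mul_le_mul hJ hN hα.le (hα.le.trans hJ)
  unfold couplingDet
  nlinarith

/-- Near the decoupled case the coefficient of `sin φ` in the acceleration is negative. -/
theorem exists_acceleration_bound {α β B : ℝ} (hα : 0 < α) (hαβ : α ≤ β) (hB : 1 ≤ B) :
    ∃ δ : ℝ, 0 < δ ∧ δ ≤ α / 2 ∧ ∃ κ : ℝ, 0 < κ ∧ ∀ q ∈ paramBox α β δ, ∀ x ∈ stateBox B,
      couplingNum₁ q x / couplingDet q x.1 ≤ -κ := by
  have hβ : 0 < β := hα.trans_le hαβ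
  set Q : ℝ := 1 * (1 + 2 * B)
  set C : ℝ := B ^ 2 * (β + β + 2 * 1 * 1) + β * Q + 1 * β + 1 * 1 * Q
  have hC : 0 < C := by positivity
  refine ⟨min (min 1 (α / 2)) (α ^ 2 / (2 * C)), by positivity,
    (min_le_left _ _).trans (min_le_right _ _), α ^ 2 / 2 / β ^ 2, by positivity, ?_⟩
  rintro ⟨J, N, μ, f⟩ hq ⟨φ, v, w⟩ ⟨-, hv, hw⟩
  have hdet := le_couplingDet hα ((min_le_left _ _).trans (min_le_right _ _)) hq φ
  obtain ⟨hJ, hN, hμ, hf⟩ := hq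
  simp only at hJ hN hμ hf hv hw hdet ⊢
  have hμ' := abs_le.2 hμ
  have hμ1 : |μ| ≤ 1 := hμ'.trans ((min_le_left _ _).trans (min_le_left _ _))
  have hμC : |μ| ≤ α ^ 2 / (2 * C) := hμ'.trans (min_le_right _ _)
  have hJ' : |J| ≤ β := abs_le.2 ⟨by linarith [hJ.1], hJ.2⟩
  have hN' : |N| ≤ β := abs_le.2 ⟨by linarith [hN.1], hN.2⟩
  have hf' : |f| ≤ β := abs_le.2 ⟨by linarith [hf.1], hf.2⟩
  have hv' : |v| ≤ 1 := abs_le.2 hv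
  have hw' : |w| ≤ B := abs_le.2 hw
  have hc := Real.abs_cos_le_one φ
  set c := Real.cos φ with hcdef
  have hq : |v * (v + 2 * w)| ≤ Q := by
    rw [abs_mul]
    have : |v + 2 * w| ≤ 1 + 2 * B := (abs_add_le _ _).trans (by
      rw [abs_mul, abs_two]; gcongr)
    exact mul_le_mul hv' this (abs_nonneg _) zero_le_one
  set q := v * (v + 2 * w) with hqdef
  have hY : |w ^ 2 * (J + N + 2 * μ * c) + J * q + c * f + μ * c * q| ≤ C := by
    have h1 : |J + N + 2 * μ * c| ≤ β + β + 2 * 1 * 1 := by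
      refine (abs_add_le _ _).trans (add_le_add ((abs_add_le _ _).trans (by gcongr)) ?_)
      rw [abs_mul, abs_mul, abs_two]
      gcongr
    have h2 : |w ^ 2 * (J + N + 2 * μ * c)| ≤ B ^ 2 * (β + β + 2 * 1 * 1) := by
      rw [abs_mul, abs_pow]
      gcongr
    have h3 : |J * q| ≤ β * Q := by rw [abs_mul]; gcongr
    have h4 : |c * f| ≤ 1 * β := by rw [abs_mul]; gcongr
    have h5 : |μ * c * q| ≤ 1 * 1 * Q := by rw [abs_mul, abs_mul]; gcongr
    exact (abs_add_le _ _).trans (add_le_add ((abs_add_le _ _).trans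
      (add_le_add ((abs_add_le _ _).trans (add_le_add h2 h3)) h4)) h5)
  have hμY : |μ * (w ^ 2 * (J + N + 2 * μ * c) + J * q + c * f + μ * c * q)| ≤ α ^ 2 / 2 := by
    rw [abs_mul]
    calc _ ≤ α ^ 2 / (2 * C) * C := by gcongr
      _ = _ := by field_simp
  have hnum : couplingNum₁ (J, N, μ, f) (φ, v, w) ≤ -(α ^ 2 / 2) := by
    have h1 : couplingNum₁ (J, N, μ, f) (φ, v, w) =
        -(μ * (w ^ 2 * (J + N + 2 * μ * c) + J * q + c * f + μ * c * q)) - J * f := by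
      simp only [couplingNum₁]
      ring
    have h2 : α * α ≤ J * f := mul_le_mul hJ.1 hf.1 hα.le (hα.le.trans hJ.1)
    rw [h1]
    nlinarith [(abs_le.1 hμY).1]
  have hdet' : couplingDet (J, N, μ, f) φ ≤ β ^ 2 := by
    have : J * N ≤ β * β := mul_le_mul hJ.2 hN.2 (hα.le.trans hN.1) hβ.le
    simp only [couplingDet]
    nlinarith [sq_nonneg (μ * Real.cos φ)]
  have hdet0 : 0 < couplingDet (J, N, μ, f) φ := lt_of_lt_of_le (by positivity) hdet
  rw [div_le_iff₀ hdet0]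
  have : α ^ 2 / 2 / β ^ 2 * couplingDet (J, N, μ, f) φ ≤ α ^ 2 / 2 / β ^ 2 * β ^ 2 := by gcongr
  rw [div_mul_cancel₀ _ (by positivity)] at this
  linarith

theorem contDiffAt_coupledField {z : (ℝ × ℝ × ℝ × ℝ) × (ℝ × ℝ × ℝ)}
    (hz : couplingDet z.1 z.2.1 ≠ 0) :
    ContDiffAt ℝ 1 (fun z : (ℝ × ℝ × ℝ × ℝ) × (ℝ × ℝ × ℝ) => coupledField z.1 z.2) z := by
  have hdet : ContDiffAt ℝ 1
      (fun z : (ℝ × ℝ × ℝ × ℝ) × (ℝ × ℝ × ℝ) => couplingDet z.1 z.2.1) z := by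
    unfold couplingDet
    fun_prop
  have hnum₁ : ContDiffAt ℝ 1
      (fun z : (ℝ × ℝ × ℝ × ℝ) × (ℝ × ℝ × ℝ) => couplingNum₁ z.1 z.2) z := by
    unfold couplingNum₁
    fun_prop
  have hnum₂ : ContDiffAt ℝ 1
      (fun z : (ℝ × ℝ × ℝ × ℝ) × (ℝ × ℝ × ℝ) => couplingNum₂ z.1 z.2) z := by
    unfold couplingNum₂
    fun_prop
  have hsin : ContDiffAt ℝ 1
      (fun z : (ℝ × ℝ × ℝ × ℝ) × (ℝ × ℝ × ℝ) => Real.sin z.2.1) z := by fun_prop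
  have hv : ContDiffAt ℝ 1
      (fun z : (ℝ × ℝ × ℝ × ℝ) × (ℝ × ℝ × ℝ) => z.2.2.1) z := by fun_prop
  exact hv.prodMk ((hsin.mul (hnum₁.div hdet hz)).prodMk (hsin.mul (hnum₂.div hdet hz)))

/-- The retraction of `ℝ` onto `[l, u]`. -/
def clamp (l u x : ℝ) : ℝ := max l (min u x)

theorem clamp_mem {l u : ℝ} (h : l ≤ u) (x : ℝ) : clamp l u x ∈ Icc l u :=
  ⟨le_max_left _ _, max_le h (min_le_left _ _)⟩

theorem clamp_of_mem {l u x : ℝ} (h : x ∈ Icc l u) : clamp l u x = x := by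
  rw [clamp, min_eq_right h.2, max_eq_right h.1]

theorem clamp_neg {u : ℝ} (h : 0 ≤ u) (x : ℝ) : clamp (-u) u (-x) = -clamp (-u) u x := by
  simp only [clamp]
  rcases le_total u x with h1 | h1 <;> rcases le_total u (-x) with h2 | h2 <;> grind

theorem lipschitzWith_clamp (l u : ℝ) : LipschitzWith 1 (clamp l u) :=
  (LipschitzWith.id.const_min u).const_max l

/-- The coordinatewise retraction onto `paramBox α β δ ×ˢ stateBox B`. -/
def boxRetract (α β δ B : ℝ) (z : (ℝ × ℝ × ℝ × ℝ) × (ℝ × ℝ × ℝ)) :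
    (ℝ × ℝ × ℝ × ℝ) × (ℝ × ℝ × ℝ) :=
  ((clamp α β z.1.1, clamp α β z.1.2.1, clamp (-δ) δ z.1.2.2.1, clamp α β z.1.2.2.2),
    (clamp (-1) 1 z.2.1, clamp (-1) 1 z.2.2.1, clamp (-B) B z.2.2.2))

theorem boxRetract_mem {α β δ B : ℝ} (hαβ : α ≤ β) (hδ : 0 ≤ δ) (hB : 0 ≤ B)
    (z : (ℝ × ℝ × ℝ × ℝ) × (ℝ × ℝ × ℝ)) :
    boxRetract α β δ B z ∈ paramBox α β δ ×ˢ stateBox B :=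
  ⟨⟨clamp_mem hαβ _, clamp_mem hαβ _, clamp_mem (by linarith) _, clamp_mem hαβ _⟩,
    clamp_mem (by norm_num) _, clamp_mem (by norm_num) _, clamp_mem (by linarith) _⟩

theorem boxRetract_of_mem {α β δ B : ℝ} {z : (ℝ × ℝ × ℝ × ℝ) × (ℝ × ℝ × ℝ)}
    (hz : z ∈ paramBox α β δ ×ˢ stateBox B) : boxRetract α β δ B z = z := by
  obtain ⟨⟨h1, h2, h3, h4⟩, h5, h6, h7⟩ := hz
  simp only [boxRetract, clamp_of_mem h1, clamp_of_mem h2, clamp_of_mem h3, clamp_of_mem h4,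
    clamp_of_mem h5, clamp_of_mem h6, clamp_of_mem h7]

theorem exists_lipschitzWith_boxRetract (α β δ B : ℝ) :
    ∃ K, LipschitzWith K (boxRetract α β δ B) := by
  have c {g : (ℝ × ℝ × ℝ × ℝ) × (ℝ × ℝ × ℝ) → ℝ} (hg : LipschitzWith 1 g) (l u : ℝ) :
      LipschitzWith 1 fun z => clamp l u (g z) := by
    exact ((lipschitzWith_clamp l u).comp hg).weaken (by simp)
  have f1 {A B : Type} [PseudoEMetricSpace A] [PseudoEMetricSpace B]
      {g : (ℝ × ℝ × ℝ × ℝ) × (ℝ × ℝ × ℝ) → A × B} (hg : LipschitzWith 1 g) :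
      LipschitzWith 1 fun z => (g z).1 := by
    exact (LipschitzWith.prod_fst.comp hg).weaken (by simp)
  have f2 {A B : Type} [PseudoEMetricSpace A] [PseudoEMetricSpace B]
      {g : (ℝ × ℝ × ℝ × ℝ) × (ℝ × ℝ × ℝ) → A × B} (hg : LipschitzWith 1 g) :
      LipschitzWith 1 fun z => (g z).2 := by
    exact (LipschitzWith.prod_snd.comp hg).weaken (by simp)
  have i : LipschitzWith 1 fun z : (ℝ × ℝ × ℝ × ℝ) × (ℝ × ℝ × ℝ) => z := LipschitzWith.id
  exact ⟨_, ((c (f1 (f1 i)) α β).prodMk ((c (f1 (f2 (f1 i))) α β).prodMk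
    ((c (f1 (f2 (f2 (f1 i)))) (-δ) δ).prodMk (c (f2 (f2 (f2 (f1 i)))) α β)))).prodMk
    ((c (f1 (f2 i)) (-1) 1).prodMk ((c (f1 (f2 (f2 i))) (-1) 1).prodMk
      (c (f2 (f2 (f2 i))) (-B) B)))⟩

/-- The coupled field cut off outside the box, with the parameters as constant coordinates. -/
noncomputable def cutoffField (α β δ B : ℝ) (z : (ℝ × ℝ × ℝ × ℝ) × (ℝ × ℝ × ℝ)) :
    (ℝ × ℝ × ℝ × ℝ) × (ℝ × ℝ × ℝ) :=
  (0, coupledField (boxRetract α β δ B z).1 (boxRetract α β δ B z).2)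

theorem cutoffField_of_mem {α β δ B : ℝ} {z : (ℝ × ℝ × ℝ × ℝ) × (ℝ × ℝ × ℝ)}
    (hz : z ∈ paramBox α β δ ×ˢ stateBox B) :
    cutoffField α β δ B z = (0, coupledField z.1 z.2) := by
  rw [cutoffField, boxRetract_of_mem hz]

theorem exists_lipschitzWith_cutoffField {α β δ B : ℝ} (hα : 0 < α) (hαβ : α ≤ β) (hδ : 0 ≤ δ)
    (hδα : δ ≤ α / 2) (hB : 0 ≤ B) :
    ∃ K L : ℝ≥0, LipschitzWith K (cutoffField α β δ B) ∧ ∀ z, ‖cutoffField α β δ B z‖ ≤ L := by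
  have hcpt : IsCompact (paramBox α β δ ×ˢ stateBox B) :=
    (isCompact_Icc.prod (isCompact_Icc.prod (isCompact_Icc.prod isCompact_Icc))).prod
      (isCompact_Icc.prod (isCompact_Icc.prod isCompact_Icc))
  have hsmooth : ∀ z ∈ paramBox α β δ ×ˢ stateBox B, ContDiffAt ℝ 1
      (fun z : (ℝ × ℝ × ℝ × ℝ) × (ℝ × ℝ × ℝ) => coupledField z.1 z.2) z := fun z hz =>
    contDiffAt_coupledField (lt_of_lt_of_le (by positivity) (le_couplingDet hα hδα hz.1 _)).ne'
  have hloc : LocallyLipschitzOn (paramBox α β δ ×ˢ stateBox B)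
      (fun z : (ℝ × ℝ × ℝ × ℝ) × (ℝ × ℝ × ℝ) => coupledField z.1 z.2) := fun z hz => by
    obtain ⟨K, t, ht, hK⟩ := (hsmooth z hz).exists_lipschitzOnWith
    exact ⟨K, t, mem_nhdsWithin_of_mem_nhds ht, hK⟩
  obtain ⟨K, hK⟩ := hloc.exists_lipschitzOnWith_of_compact hcpt
  obtain ⟨K', hK'⟩ := exists_lipschitzWith_boxRetract α β δ B
  obtain ⟨L, hL⟩ := hcpt.exists_bound_of_continuousOn
    (fun z hz => (hsmooth z hz).continuousAt.continuousWithinAt)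
  have hcomp : LipschitzWith (K * K') fun z =>
      coupledField (boxRetract α β δ B z).1 (boxRetract α β δ B z).2 := by
    rw [← lipschitzOnWith_univ]
    exact hK.comp hK'.lipschitzOnWith fun z _ => boxRetract_mem hαβ hδ hB z
  refine ⟨_, L.toNNReal, (LipschitzWith.const 0).prodMk hcomp, fun z => ?_⟩
  have := hL _ (boxRetract_mem hαβ hδ hB z)
  rw [cutoffField, Prod.norm_mk, norm_zero, max_eq_right (norm_nonneg _)]
  exact this.trans (Real.le_coe_toNNReal L)

/-- The reversor `φ ↦ -φ`. -/
noncomputable def reflectAngle :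
    ((ℝ × ℝ × ℝ × ℝ) × (ℝ × ℝ × ℝ)) →L[ℝ] (ℝ × ℝ × ℝ × ℝ) × (ℝ × ℝ × ℝ) :=
  (ContinuousLinearMap.id ℝ _).prodMap
    ((-ContinuousLinearMap.id ℝ ℝ).prodMap (ContinuousLinearMap.id ℝ (ℝ × ℝ)))

theorem reflectAngle_apply (z : (ℝ × ℝ × ℝ × ℝ) × (ℝ × ℝ × ℝ)) :
    reflectAngle z = (z.1, (-z.2.1, z.2.2)) := by
  simp [reflectAngle, Prod.map]

theorem cutoffField_reflectAngle (α β δ B : ℝ) (z : (ℝ × ℝ × ℝ × ℝ) × (ℝ × ℝ × ℝ)) :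
    cutoffField α β δ B (reflectAngle z) = -reflectAngle (cutoffField α β δ B z) := by
  simp [reflectAngle_apply, cutoffField, boxRetract, coupledField, couplingNum₁, couplingNum₂,
    couplingDet, clamp_neg (zero_le_one (α := ℝ))]

theorem cutoffField_equilibrium (α β δ B : ℝ) (q : ℝ × ℝ × ℝ × ℝ) (w : ℝ) :
    cutoffField α β δ B (q, (0, 0, w)) = 0 := by
  have h : clamp (-1) 1 0 = 0 := clamp_of_mem (by simp)
  simp [cutoffField, boxRetract, coupledField, h]

end Pendulum

section PendulumFamily

open Filter Topology
open scoped NNReal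

theorem half_mul_le_sin {x : ℝ} (h0 : 0 ≤ x) (h1 : x ≤ 1) : x / 2 ≤ Real.sin x := by
  have hpi := Real.pi_gt_three
  have hpi' := Real.pi_le_four
  have h := Real.mul_le_sin h0 (by linarith)
  have : (1 : ℝ) / 2 ≤ 2 / Real.pi := by
    rw [div_le_div_iff₀ two_pos Real.pi_pos]
    linarith
  nlinarith

/-- Near the decoupled case the coupled system has a two-parameter family of periodic solutions
that depends continuously on the parameters. -/
theorem exists_periodic_family_coupledField {α β R : ℝ} (hα : 0 < α) (hαβ : α ≤ β) (hR : 0 < R) :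
    ∃ δ : ℝ, 0 < δ ∧ δ ≤ α / 2 ∧ ∀ η : ℝ, 0 < η → ∃ (r : ℝ)
      (X : ℝ × ℝ × ℝ × ℝ → ℝ × ℝ → ℝ → ℝ × ℝ × ℝ) (τ : ℝ × ℝ × ℝ × ℝ → ℝ × ℝ → ℝ),
      0 < r ∧
      Continuous (fun p : (ℝ × ℝ × ℝ × ℝ) × (ℝ × ℝ) × ℝ => X p.1 p.2.1 p.2.2) ∧
      ContinuousOn (fun p : (ℝ × ℝ × ℝ × ℝ) × (ℝ × ℝ) => τ p.1 p.2)
        (paramBox α β δ ×ˢ (Ioo 0 r ×ˢ Ioo (-R) R)) ∧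
      (∀ q u w s t, X q u s = X q w t → ∀ h, X q u (s + h) = X q w (t + h)) ∧
      ∀ q ∈ paramBox α β δ, ∀ u ∈ Ioo 0 r ×ˢ Ioo (-R) R,
        X q u 0 = (0, u) ∧ (∀ t, HasDerivAt (X q u) (coupledField q (X q u t)) t) ∧
        (∀ t, |(X q u t).1| < η ∧ |(X q u t).2.1| < η) ∧
        Function.Periodic (X q u) (2 * τ q u) ∧
        IsFirstReturn (fun t => (X q u t).1) (τ q u) ∧ (X q u (τ q u)).2.1 < 0 ∧
        ∀ t ∈ Ioo (τ q u) (2 * τ q u), (X q u t).1 < 0 := by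
  obtain ⟨δ, hδ, hδα, κ, hκ, hacc⟩ :=
    exists_acceleration_bound (B := R + 1) hα hαβ (by linarith)
  refine ⟨δ, hδ, hδα, fun η hη => ?_⟩
  obtain ⟨K, L, hK, hL⟩ :=
    exists_lipschitzWith_cutoffField (B := R + 1) hα hαβ hδ.le hδα (by linarith)
  set f := cutoffField α β δ (R + 1) with hf
  choose Φ hΦ0 hΦ using hK.exists_global_solution hL
  have hfst (z t) : (Φ z t).1 = z.1 := by
    have h : ∀ t, HasDerivAt (fun s => (Φ z s).1) 0 t := fun t => (hΦ z t).fst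
    rw [is_const_of_deriv_eq_zero (fun t => (h t).differentiableAt) (fun t => (h t).deriv) t 0,
      hΦ0]
  have hsnd (z t) : HasDerivAt (fun s => (Φ z s).2) (f (Φ z t)).2 t := (hΦ z t).snd
  have hφ (z t) : HasDerivAt (fun s => (Φ z s).2.1) (f (Φ z t)).2.1 t := (hsnd z t).fst
  have hv (z t) : HasDerivAt (fun s => (Φ z s).2.2.1) (f (Φ z t)).2.2.1 t := (hsnd z t).snd.fst
  have hcont : Continuous fun p : ((ℝ × ℝ × ℝ × ℝ) × (ℝ × ℝ × ℝ)) × ℝ => Φ p.1 p.2 :=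
    hK.continuous_flow hΦ0 hΦ
  set ω : ℝ := Real.sqrt (κ / 2)
  have hω : 0 < ω := Real.sqrt_pos.2 (by positivity)
  have hω2 : ω ^ 2 = κ / 2 := Real.sq_sqrt (by positivity)
  set T : ℝ := Real.pi / ω
  have hT : 0 < T := div_pos Real.pi_pos hω
  set m : ℝ := min η 1
  have hm : 0 < m := lt_min hη one_pos
  set r : ℝ := m / Real.exp (K * T) with hr
  set ι : (ℝ × ℝ × ℝ × ℝ) × (ℝ × ℝ) → (ℝ × ℝ × ℝ × ℝ) × (ℝ × ℝ × ℝ) :=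
    fun p => (p.1, (0, p.2)) with hι
  have hιc : Continuous ι := by fun_prop
  set S := paramBox α β δ ×ˢ (Ioo 0 r ×ˢ Ioo (-R) R)
  have hsmall : ∀ p ∈ S, ∀ t ∈ Icc 0 T, |(Φ (ι p) t).2.1| < m ∧ |(Φ (ι p) t).2.2.1| < m ∧
      |(Φ (ι p) t).2.2.2 - p.2.2| < m := by
    intro p hp t ht
    have heq : ∀ t : ℝ, HasDerivAt (fun _ : ℝ => ((p.1, (0, 0, p.2.2)) :
        (ℝ × ℝ × ℝ × ℝ) × (ℝ × ℝ × ℝ))) (f (p.1, (0, 0, p.2.2))) t := fun t => by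
      rw [hf, cutoffField_equilibrium]
      exact hasDerivAt_const _ _
    have h1 := hK.dist_solution_le_of_nonneg (hΦ (ι p)) heq ht.1
    have h2 : dist (ι p) (p.1, (0, 0, p.2.2)) = p.2.1 := by
      simp [hι, Prod.dist_eq, abs_of_pos hp.2.1.1, hp.2.1.1.le]
    have h3 : p.2.1 * Real.exp (K * t) < m := by
      calc p.2.1 * Real.exp (K * t) ≤ p.2.1 * Real.exp (K * T) := by
            have := hp.2.1.1.le
            gcongr
            exact ht.2
        _ < m := (lt_div_iff₀ (Real.exp_pos _)).1 hp.2.1.2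
    rw [hΦ0, h2] at h1
    have h4 := h1.trans_lt h3
    simp only [Prod.dist_eq, max_lt_iff, Real.dist_eq, sub_zero] at h4
    exact h4.2
  have hmem' : ∀ p ∈ S, ∀ t ∈ Icc 0 T,
      Φ (ι p) t ∈ paramBox α β δ ×ˢ stateBox (R + 1) := by
    intro p hp t ht
    obtain ⟨h1, h2, h3⟩ := hsmall p hp t ht
    have hm1 : m ≤ 1 := min_le_right _ _
    have h3' := abs_lt.1 h3
    refine ⟨by rw [hfst]; exact hp.1, abs_le.1 (h1.le.trans hm1), abs_le.1 (h2.le.trans hm1),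
      ?_, ?_⟩
    · linarith [hp.2.2.1]
    · linarith [hp.2.2.2]
  have hforce : ∀ p ∈ S, ∀ t ∈ Ioc 0 T, 0 < (Φ (ι p) t).2.1 →
      (f (Φ (ι p) t)).2.2.1 ≤ -ω ^ 2 * (Φ (ι p) t).2.1 := by
    intro p hp t ht hpos
    have hmem := hmem' p hp t (Ioc_subset_Icc_self ht)
    rw [hf, cutoffField_of_mem hmem]
    have h1 := hacc _ hmem.1 _ hmem.2
    have h2 := half_mul_le_sin hpos.le hmem.2.1.2
    simp only [coupledField]
    rw [hω2]
    calc _ ≤ Real.sin (Φ (ι p) t).2.1 * -κ := by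
          have : 0 ≤ Real.sin (Φ (ι p) t).2.1 := by linarith
          gcongr
      _ ≤ _ := by nlinarith
  have hφ' : ∀ p ∈ S, ∀ t ∈ Icc 0 T,
      HasDerivAt (fun s => (Φ (ι p) s).2.1) (Φ (ι p) t).2.2.1 t := by
    intro p hp t ht
    refine (hφ (ι p) t).congr_deriv ?_
    rw [hf, cutoffField_of_mem (hmem' p hp t ht)]
    rfl
  have hstart : ∀ p ∈ S, (Φ (ι p) 0).2.1 = 0 ∧ 0 < (Φ (ι p) 0).2.2.1 := by
    intro p hp
    rw [hΦ0]
    exact ⟨rfl, hp.2.1.1⟩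
  have hreturn : ∀ p ∈ S, ∃ τ, τ ∈ Ioc 0 T ∧ IsFirstReturn (fun t => (Φ (ι p) t).2.1) τ := by
    intro p hp
    have hc : Continuous fun t => (Φ (ι p) t).2.1 :=
      (hcont.comp (Continuous.prodMk_right (ι p))).snd.fst
    exact exists_isFirstReturn hc (hφ' p hp 0 (left_mem_Icc.2 hT.le)) (hstart p hp).1
      (hstart p hp).2 (exists_nonpos_of_sturm hω (hφ' p hp) (fun t _ => hv (ι p) t)
        (hstart p hp).1 (hforce p hp))
  choose! τ hτT hτ using hreturn
  have hneg : ∀ p ∈ S, (Φ (ι p) (τ p)).2.2.1 < 0 := by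
    intro p hp
    have hsub : Icc 0 (τ p) ⊆ Icc 0 T := Icc_subset_Icc_right (hτT p hp).2
    refine (hτ p hp).deriv_neg (fun t ht => hφ' p hp t (hsub ht)) (fun t _ => hv (ι p) t)
      (hstart p hp).1 fun t ht => ?_
    have hpos := (hτ p hp).pos_before t ht
    refine (hforce p hp t ⟨ht.1, ht.2.le.trans (hτT p hp).2⟩ hpos).trans_lt ?_
    nlinarith [mul_pos (pow_pos hω 2) hpos]
  have hrev {p} (hp : p ∈ S) {t₀ : ℝ} (h0 : (Φ (ι p) t₀).2.1 = 0) :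
      reflectAngle (Φ (ι p) t₀) = Φ (ι p) t₀ := by
    rw [reflectAngle_apply, h0, neg_zero]
    ext <;> simp [h0]
  have hper : ∀ p ∈ S, Function.Periodic (Φ (ι p)) (2 * τ p) := fun p hp =>
    hK.periodic_of_reversible reflectAngle (cutoffField_reflectAngle α β δ (R + 1)) (hΦ (ι p))
      (hrev hp (hstart p hp).1) (hrev hp (hτ p hp).zero)
  have hsymm : ∀ p ∈ S, ∀ t, Φ (ι p) (2 * τ p - t) = reflectAngle (Φ (ι p) t) := fun p hp t =>
    hK.reversible_solution reflectAngle (cutoffField_reflectAngle α β δ (R + 1)) (hΦ (ι p))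
      (hrev hp (hτ p hp).zero) t
  have hreduce : ∀ p ∈ S, ∀ t, ∃ s ∈ Icc 0 T,
      Φ (ι p) t = Φ (ι p) s ∨ Φ (ι p) t = reflectAngle (Φ (ι p) s) := by
    intro p hp t
    have hτp := (hτT p hp).1
    obtain ⟨s, hs, hs'⟩ := (hper p hp).exists_mem_Ico₀ (by linarith) t
    rcases le_total s (τ p) with h | h
    · exact ⟨s, ⟨hs.1, h.trans (hτT p hp).2⟩, Or.inl hs'⟩
    · refine ⟨2 * τ p - s, ⟨by linarith [hs.2], by linarith [(hτT p hp).2]⟩, Or.inr ?_⟩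
      rw [hs', ← hsymm p hp, sub_sub_cancel]
  have hmem : ∀ p ∈ S, ∀ t, Φ (ι p) t ∈ paramBox α β δ ×ˢ stateBox (R + 1) := by
    intro p hp t
    obtain ⟨s, hs, h | h⟩ := hreduce p hp t
    · exact h ▸ hmem' p hp s hs
    · rw [h, reflectAngle_apply]
      obtain ⟨h1, h2, h3⟩ := hmem' p hp s hs
      exact ⟨h1, ⟨by simpa using neg_le_neg h2.2, by simpa using neg_le_neg h2.1⟩, h3⟩
  have hmη : m ≤ η := min_le_left _ _
  refine ⟨r, fun q u t => (Φ (ι (q, u)) t).2, fun q u => τ (q, u), by positivity, ?_, ?_, ?_, ?_⟩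
  · exact (hcont.comp ((hιc.comp (continuous_fst.prodMk continuous_snd.fst)).prodMk
      continuous_snd.snd)).snd
  · have hvc : Continuous fun p : ((ℝ × ℝ × ℝ × ℝ) × (ℝ × ℝ)) × ℝ => (f (Φ (ι p.1) p.2)).2.1 :=
      (hK.continuous.comp (hcont.comp ((hιc.comp continuous_fst).prodMk continuous_snd))).snd.fst
    have hvel : ∀ p ∈ S, ∀ t, (f (Φ (ι p) t)).2.1 = (Φ (ι p) t).2.2.1 := by
      intro p hp t
      rw [hf, cutoffField_of_mem (hmem p hp t)]
      rfl
    refine continuousOn_firstReturn (fun p t => hφ (ι p) t)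
      (hcont.comp ((hιc.comp continuous_fst).prodMk continuous_snd)).snd.fst hvc
      (fun p hp => (hstart p hp).1) (fun p hp => ?_) hτ (fun p hp => ?_)
    · rw [hvel p hp]
      exact (hstart p hp).2
    · rw [hvel p hp]
      exact hneg p hp
  · intro q u w s t hst h
    have hst' : Φ (ι (q, u)) s = Φ (ι (q, w)) t := Prod.ext (by rw [hfst, hfst]) hst
    have := ODE_solution_unique_univ (v := fun _ => f) (s := fun _ => univ) (K := K) (t₀ := 0)
      (f := fun h => Φ (ι (q, u)) (s + h)) (g := fun h => Φ (ι (q, w)) (t + h))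
      (fun _ => hK.lipschitzOnWith) (fun h => ⟨(hΦ _ _).comp_const_add s h, mem_univ _⟩)
      (fun h => ⟨(hΦ _ _).comp_const_add t h, mem_univ _⟩) (by simpa using hst')
    exact congrArg Prod.snd (congrFun this h)
  · intro q hq u hu
    have hp : (q, u) ∈ S := ⟨hq, hu⟩
    beta_reduce
    refine ⟨by rw [hΦ0], fun t => ?_, fun t => ?_, fun t => congrArg Prod.snd (hper _ hp t),
      hτ _ hp, hneg _ hp, fun t ht => ?_⟩
    · refine (hsnd _ t).congr_deriv ?_
      rw [hf, cutoffField_of_mem (hmem _ hp t), hfst]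
    · obtain ⟨s, hs, h | h⟩ := hreduce _ hp t <;> obtain ⟨h1, h2, -⟩ := hsmall _ hp s hs
      · rw [h]
        exact ⟨h1.trans_le hmη, h2.trans_le hmη⟩
      · rw [h, reflectAngle_apply, abs_neg]
        exact ⟨h1.trans_le hmη, h2.trans_le hmη⟩
    · have h1 := (hτ _ hp).pos_before (2 * τ (q, u) - t) ⟨by linarith [ht.2], by linarith [ht.1]⟩
      simp only [hsymm _ hp, reflectAngle_apply] at h1
      linarith

end PendulumFamily

namespace Ziegler

/-- The parameters of `coupledField` that correspond to a Ziegler pendulum. -/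
noncomputable def couplingParams (P : Ziegler) : ℝ × ℝ × ℝ × ℝ :=
  (P.A₁₁, (P.m₁ + P.m₂ + P.m₃) * P.l₂ ^ 2, P.imbalance * P.l₂, -P.F * P.l₁)

theorem continuous_couplingParams : Continuous couplingParams := by
  have h : Continuous toTuple := continuous_induced_dom
  have h1 : Continuous m₁ := h.fst
  have h2 : Continuous m₂ := h.snd.fst
  have h3 : Continuous m₃ := h.snd.snd.fst
  have h4 : Continuous l₁ := h.snd.snd.snd.fst
  have h5 : Continuous l₂ := h.snd.snd.snd.snd.fst
  have h6 : Continuous l₃ := h.snd.snd.snd.snd.snd.fst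
  have h7 : Continuous F := h.snd.snd.snd.snd.snd.snd.fst
  unfold couplingParams A₁₁ imbalance
  fun_prop

theorem couplingParams_mem {a b δ : ℝ} (ha : 0 < a) {P : Ziegler}
    (hP : P ∈ nearDecoupled a b (δ / b)) :
    P.couplingParams ∈ paramBox (min (a ^ 2) (2 * a ^ 3)) (max (b ^ 2) (3 * b ^ 3)) δ := by
  obtain ⟨-, -, h1, h2, h3, h4, h5, h6, h7, h8⟩ := hP
  have hb : 0 < b := ha.trans_le (h1.1.trans h1.2)
  have lower {x y : ℝ} (hx : a ≤ x) (hy : a ≤ y) : a ^ 3 ≤ x * y ^ 2 := by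
    have := mul_le_mul hx (pow_le_pow_left₀ ha.le hy 2) (by positivity) (ha.le.trans hx)
    linarith [this, show a * a ^ 2 = a ^ 3 by ring]
  have upper {x y : ℝ} (hx : x ∈ Icc a b) (hy : y ∈ Icc a b) : x * y ^ 2 ≤ b ^ 3 := by
    have := mul_le_mul hx.2 (pow_le_pow_left₀ (ha.le.trans hy.1) hy.2 2) (sq_nonneg _) hb.le
    linarith [this, show b * b ^ 2 = b ^ 3 by ring]
  have ha3 : 0 < a ^ 3 := by positivity
  have hb3 : 0 < b ^ 3 := by positivity
  refine ⟨⟨(min_le_right _ _).trans ?_, le_trans ?_ (le_max_right _ _)⟩,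
    ⟨(min_le_right _ _).trans ?_, le_trans ?_ (le_max_right _ _)⟩, ?_,
    ⟨(min_le_left _ _).trans ?_, le_trans ?_ (le_max_left _ _)⟩⟩
  · simp only [couplingParams, A₁₁]
    linarith [lower h1.1 h4.1, lower h3.1 h6.1]
  · simp only [couplingParams, A₁₁]
    linarith [upper h1 h4, upper h3 h6]
  · simp only [couplingParams]
    linarith [lower h1.1 h5.1, lower h2.1 h5.1, lower h3.1 h5.1]
  · simp only [couplingParams]
    linarith [upper h1 h5, upper h2 h5, upper h3 h5]
  · refine abs_le.1 ?_
    simp only [couplingParams]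
    rw [abs_mul, abs_of_pos (ha.trans_le h5.1)]
    calc _ ≤ δ / b * b := mul_le_mul h8.le h5.2 (ha.le.trans h5.1) ((abs_nonneg _).trans h8.le)
      _ = δ := by field_simp
  · simp only [couplingParams]
    rw [sq]
    exact mul_le_mul (by linarith [h7.2]) h4.1 ha.le (by linarith [h7.2])
  · simp only [couplingParams]
    rw [sq]
    exact mul_le_mul (by linarith [h7.1]) h4.2 (ha.le.trans h4.1) hb.le

theorem solve_first_of_two {A B C r s : ℝ} (hB : B ≠ 0) (hD : A * B - C ^ 2 ≠ 0) :
    (r - C / B * s) * (A - C * C / B)⁻¹ = (B * r - C * s) / (A * B - C ^ 2) := by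
  have h : A - C * C / B = (A * B - C ^ 2) / B := by
    field_simp
  rw [h, inv_div]
  field_simp

theorem reducedField_eq_coupledField {P : Ziegler} (hk₁ : P.k₁ = 0) (hk₂ : P.k₂ = 0)
    (hA : 0 < P.A₁₁) (x : ℝ × ℝ × ℝ) (hD : 0 < couplingDet P.couplingParams x.1) :
    P.reducedField x = coupledField P.couplingParams x := by
  have hdet : P.A₁₁ * P.A₂₂ x.1 - P.A₁₂ x.1 ^ 2 = couplingDet P.couplingParams x.1 := by
    simp only [couplingDet, couplingParams, A₁₁, A₁₂, A₂₂, imbalance]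
    ring
  have hA₂ : P.A₂₂ x.1 ≠ 0 := by
    intro h
    rw [h, mul_zero] at hdet
    linarith [sq_nonneg (P.A₁₂ x.1)]
  have hD' : P.A₁₁ * P.A₂₂ x.1 - P.A₁₂ x.1 ^ 2 ≠ 0 := hdet ▸ hD.ne'
  have h1 : P.A₂₂ x.1 * P.r₁ x.1 x.2.2 - P.A₁₂ x.1 * P.r₂ x.1 0 x.2.1 x.2.2 =
      Real.sin x.1 * couplingNum₁ P.couplingParams x := by
    simp only [couplingNum₁, couplingParams, A₁₁, A₁₂, A₂₂, r₁, r₂, imbalance, hk₁, hk₂]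
    ring
  have h2 : P.A₁₁ * P.r₂ x.1 0 x.2.1 x.2.2 - P.A₁₂ x.1 * P.r₁ x.1 x.2.2 =
      Real.sin x.1 * couplingNum₂ P.couplingParams x := by
    simp only [couplingNum₂, couplingParams, A₁₁, A₁₂, r₁, r₂, imbalance, hk₁, hk₂]
    ring
  simp only [reducedField, coupledField, A₂₁]
  rw [solve_first_of_two hA₂ hD', solve_first_of_two hA.ne' (by rwa [mul_comm]),
    mul_comm (P.A₂₂ x.1) P.A₁₁, hdet, h1, h2, mul_div_assoc, mul_div_assoc]

theorem coupledField_of_imbalance_eq_zero {P : Ziegler} (h : P.imbalance = 0)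
    (hA : P.A₁₁ ≠ 0) (x : ℝ × ℝ × ℝ) :
    coupledField P.couplingParams x =
      (x.2.1, P.F * P.l₁ * Real.sin x.1 / ((P.m₁ + P.m₂ + P.m₃) * P.l₂ ^ 2),
        -(P.F * P.l₁ * Real.sin x.1 / ((P.m₁ + P.m₂ + P.m₃) * P.l₂ ^ 2))) := by
  have hdet : couplingDet P.couplingParams x.1 =
      P.A₁₁ * ((P.m₁ + P.m₂ + P.m₃) * P.l₂ ^ 2) := by
    simp [couplingDet, couplingParams, h]
  have h1 : couplingNum₁ P.couplingParams x = P.A₁₁ * (P.F * P.l₁) := by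
    simp [couplingNum₁, couplingParams, h]
  have h2 : couplingNum₂ P.couplingParams x = P.A₁₁ * -(P.F * P.l₁) := by
    simp [couplingNum₂, couplingParams, h]
  simp only [coupledField]
  rw [hdet, h1, h2, mul_div_mul_left _ _ hA, mul_div_mul_left _ _ hA]
  refine Prod.ext rfl (Prod.ext ?_ ?_) <;> simp only <;> ring

end Ziegler

theorem proposition7 (a b R : ℝ) (ha : 0 < a) (hab : a ≤ b) (hR : 0 < R) :
    ∃ ε : ℝ, 0 < ε ∧ ∀ η : ℝ, 0 < η →
      ∃ (r : ℝ) (γ : Ziegler → ℝ × ℝ → ℝ → ℝ × ℝ × ℝ) (T : Ziegler → ℝ × ℝ → ℝ),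
        0 < r ∧
        -- each system close to the decoupled one has a two-parameter family of periodic solutions
        (∀ P ∈ Ziegler.nearDecoupled a b ε,
          P.IsPeriodicFamily (Ioo 0 r ×ˢ Ioo (-R) R) (γ P) (T P)) ∧
        -- parametrized by the initial velocities on the plane `φ₁ = 0`, near `φ₁ = v₁ = 0`, and
        -- meeting that plane exactly twice per period, transversely
        (∀ P ∈ Ziegler.nearDecoupled a b ε, ∀ u ∈ Ioo 0 r ×ˢ Ioo (-R) R,
          γ P u 0 = (0, u.1, u.2) ∧
          (∀ t, |(γ P u t).1| < η ∧ |(γ P u t).2.1| < η) ∧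
          ∃ τ ∈ Ioo 0 (T P u), (γ P u τ).2.1 < 0 ∧
            ∀ t ∈ Ico 0 (T P u), (γ P u t).1 = 0 ↔ t = 0 ∨ t = τ) ∧
        -- it is a perturbation of a family of solutions of the decoupled pendulum equation
        (∀ P ∈ Ziegler.nearDecoupled a b ε, P.imbalance = 0 →
          ∀ u ∈ Ioo 0 r ×ˢ Ioo (-R) R, P.IsDecoupledSolution (γ P u)) ∧
        ContinuousOn (fun q : Ziegler × (ℝ × ℝ) × ℝ => γ q.1 q.2.1 q.2.2)
          (Ziegler.nearDecoupled a b ε ×ˢ (Ioo 0 r ×ˢ Ioo (-R) R) ×ˢ univ) ∧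
        ContinuousOn (fun q : Ziegler × (ℝ × ℝ) => T q.1 q.2)
          (Ziegler.nearDecoupled a b ε ×ˢ (Ioo 0 r ×ˢ Ioo (-R) R)) := by
  have hb : 0 < b := ha.trans_le hab
  set α := min (a ^ 2) (2 * a ^ 3)
  set β := max (b ^ 2) (3 * b ^ 3)
  have hα : 0 < α := by positivity
  have hαβ : α ≤ β := (min_le_left _ _).trans ((pow_le_pow_left₀ ha.le hab 2).trans
    (le_max_left _ _))
  obtain ⟨δ, hδ, hδα, hfam⟩ := exists_periodic_family_coupledField hα hαβ hR
  refine ⟨δ / b, by positivity, fun η hη => ?_⟩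
  obtain ⟨r, X, τ, hr, hX, hτ, hshift, hsol⟩ := hfam η hη
  have hmem : ∀ P ∈ Ziegler.nearDecoupled a b (δ / b), P.couplingParams ∈ paramBox α β δ :=
    fun P hP => Ziegler.couplingParams_mem ha hP
  have hA : ∀ P ∈ Ziegler.nearDecoupled a b (δ / b), 0 < P.A₁₁ :=
    fun P hP => hα.trans_le (hmem P hP).1.1
  have hzero : ∀ q ∈ paramBox α β δ, ∀ u ∈ Ioo 0 r ×ˢ Ioo (-R) R, ∀ t ∈ Ico 0 (2 * τ q u),
      (X q u t).1 = 0 ↔ t = 0 ∨ t = τ q u := by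
    intro q hq u hu t ht
    obtain ⟨h0, -, -, -, hret, -, hneg⟩ := hsol q hq u hu
    constructor
    · intro hz
      by_contra! hne
      rcases lt_or_gt_of_ne hne.2 with h | h
      · exact (hret.pos_before t ⟨lt_of_le_of_ne ht.1 hne.1.symm, h⟩).ne' hz
      · exact (hneg t ⟨h, ht.2⟩).ne hz
    · rintro (rfl | rfl)
      · rw [h0]
      · exact hret.zero
  have hXγ : Continuous fun q : Ziegler × (ℝ × ℝ) × ℝ => X q.1.couplingParams q.2.1 q.2.2 :=
    hX.comp ((Ziegler.continuous_couplingParams.comp continuous_fst).prodMk continuous_snd)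
  have hT : ContinuousOn (fun q : Ziegler × (ℝ × ℝ) => 2 * τ q.1.couplingParams q.2)
      (Ziegler.nearDecoupled a b (δ / b) ×ˢ (Ioo 0 r ×ˢ Ioo (-R) R)) :=
    (hτ.comp ((Ziegler.continuous_couplingParams.comp continuous_fst).prodMk
      continuous_snd).continuousOn fun p hp => ⟨hmem _ hp.1, hp.2⟩).const_mul 2
  refine ⟨r, fun P => X P.couplingParams, fun P u => 2 * τ P.couplingParams u, hr,
    fun P hP => ⟨?_, ?_, ?_, ?_, ?_, ?_, ?_, ?_, ?_⟩, ?_, ?_, hXγ.continuousOn, hT⟩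
  · exact isOpen_Ioo.prod isOpen_Ioo
  · exact ⟨(r / 2, 0), ⟨by simp [hr], by simp [hr]⟩, by simp [hR], by simp [hR]⟩
  · intro u hu t
    have hdet := le_couplingDet hα hδα (hmem P hP)
    rw [Ziegler.reducedField_eq_coupledField hP.1 hP.2.1 (hA P hP) _
      (lt_of_lt_of_le (by positivity) (hdet _))]
    exact (hsol _ (hmem P hP) u hu).2.1 t
  · intro u hu
    exact mul_pos two_pos (hsol _ (hmem P hP) u hu).2.2.2.2.1.pos
  · intro u hu
    exact (hsol _ (hmem P hP) u hu).2.2.2.1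
  · intro u hu s hs hper
    obtain ⟨h0, -, -, -, -, hv, -⟩ := hsol _ (hmem P hP) u hu
    by_contra! hlt
    have hX0 : X P.couplingParams u s = (0, u) := by
      have := hper 0
      rw [zero_add] at this
      exact this.trans h0
    rcases (hzero _ (hmem P hP) u hu s ⟨hs.le, hlt⟩).1 (by rw [hX0]) with h | h
    · exact hs.ne' h
    · rw [← h, hX0] at hv
      exact lt_asymm hv hu.1.1
  · intro u hu w hw huw
    rw [Set.disjoint_left]
    rintro _ ⟨s, rfl⟩ ⟨t, hst⟩
    obtain ⟨h0, -, -, hper, hret, hv, -⟩ := hsol _ (hmem P hP) u hu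
    have h1 := hshift _ _ _ _ _ hst.symm (-t)
    rw [add_neg_cancel, (hsol _ (hmem P hP) w hw).1] at h1
    obtain ⟨y, hy, hy'⟩ := hper.exists_mem_Ico₀ (mul_pos two_pos hret.pos) (s + -t)
    rw [h1] at hy'
    rcases (hzero _ (hmem P hP) u hu y hy).1 (by rw [← hy']) with h | h
    · rw [h, h0] at hy'
      exact huw (congrArg Prod.snd hy').symm
    · rw [← h, ← hy'] at hv
      exact lt_asymm hv hw.1.1
  · exact (hX.comp (Continuous.prodMk_right P.couplingParams |>.comp
      (continuous_fst.prodMk continuous_snd))).continuousOn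
  · exact hT.comp (Continuous.prodMk_right P).continuousOn fun u hu => ⟨hP, hu⟩
  · intro P hP u hu
    obtain ⟨h0, -, hη', -, hret, hv, -⟩ := hsol _ (hmem P hP) u hu
    exact ⟨h0, hη', _, ⟨hret.pos, by linarith [hret.pos]⟩, hv, hzero _ (hmem P hP) u hu⟩
  · intro P hP himb u hu t
    rw [← Ziegler.coupledField_of_imbalance_eq_zero himb (hA P hP).ne']
    exact (hsol _ (hmem P hP) u hu).2.1 t
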